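/- An algebra means a complex algebra, possibly without unit. For a complex Hilbert space $H$, an \emph{R$^*$-algebra} in $B(H)$ is a (not necessarily closed) $^*$-subalgebra $A\subset B(H)$ that is von Neumann regular: for each $x\in A$ there is $y\in A$ with $xyx=x$. Let $\mathcal P(A)=\{p\in A\mid p=p^2=p^*\}$, ordered by $p\le q\iff pH\subset qH$. An \emph{atom} of $A$ is a minimal element of $\mathcal P(A)\setminus\{0\}$, and an R$^*$-algebra $A$ is \emph{purely atomic} if every element of $\mathcal P(A)$ is a sum of finitely many atoms of $A$ (the empty sum being $0$). For a complex inner product space $V$ with completion $H$, let $F(V)$ be the $^*$-algebra of all finite-rank operators $x\in B(H)$ such that the ranges of $x$ and of $x^*$ are contained in $V$. For a family $(V_i)_{i\in I}$ of complex inner product spaces with completions $H_i$, let $p_i$ be the projection of the Hilbert space direct sum $K=\bigoplus_{i\in I}H_i$ onto $H_i$, and let $\bigoplus_{i\in I}F(V_i)\subset B(K)$ be the $^*$-subalgebra of $B(K)$ generated by the operators $p_i x p_i$ with $i\in I$, $x\in F(V_i)$. \textbf{Theorem.} For every family $(V_i)_{i\in I}$ of complex inner product spaces, $\bigoplus_{i\in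 I}F(V_i)$ is a purely atomic R$^*$-algebra. Conversely, every purely atomic R$^*$-algebra is $^*$-isomorphic to $\bigoplus_{i\in I}F(V_i)$ for some family $(V_i)_{i\in I}$ of complex inner product spaces. -/

import Mathlib

universe u v w

/-- The bounded operators `B(H)` on a complex Hilbert space `H`. -/
abbrev Bdd (H : Type*) [NormedAddCommGroup H] [InnerProductSpace ℂ H] : Type _ := H →L[ℂ] H

section Basic

variable {H : Type*} [NormedAddCommGroup H] [InnerProductSpace ℂ H] [CompleteSpace H]

/-- An R*-algebra in `B(H)`: a (not necessarily closed, not necessarily unital) complex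
*-subalgebra `A` of `B(H)` that is regular in the sense of von Neumann. -/
def IsRStarAlgebra (A : NonUnitalStarSubalgebra ℂ (Bdd H)) : Prop :=
  ∀ x ∈ A, ∃ y ∈ A, x * y * x = x

/-- The set `P(A)` of projections `p = p² = p*` in `A`. -/
def projections (A : NonUnitalStarSubalgebra ℂ (Bdd H)) : Set (Bdd H) :=
  {p | p ∈ A ∧ IsStarProjection p}

/-- The order on projections: `p ≤ q` iff `pH ⊆ qH`. -/
def ProjLE (p q : Bdd H) : Prop := Set.range p ⊆ Set.range q

/-- An atom of `A`: a minimal element of `P(A) \ {0}`. -/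
def IsAtomOf (A : NonUnitalStarSubalgebra ℂ (Bdd H)) (p : Bdd H) : Prop :=
  p ∈ projections A \ {0} ∧ ∀ q ∈ projections A \ {0}, ProjLE q p → q = p

/-- `A` is purely atomic: every projection of `A` is a sum of finitely many atoms of `A`
(the empty sum being `0`). -/
def IsPurelyAtomic (A : NonUnitalStarSubalgebra ℂ (Bdd H)) : Prop :=
  ∀ p ∈ projections A, ∃ (n : ℕ) (f : Fin n → Bdd H), (∀ k, IsAtomOf A (f k)) ∧ p = ∑ k, f k

/-- The adjoint of a finite-rank bounded operator has finite rank. -/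
theorem finiteDimensional_range_star {x : Bdd H}
    (hx : FiniteDimensional ℂ (LinearMap.range (x : H →ₗ[ℂ] H))) :
    FiniteDimensional ℂ (LinearMap.range ((star x : Bdd H) : H →ₗ[ℂ] H)) := by
  set K := LinearMap.range (x : H →ₗ[ℂ] H) with hK
  have hle : LinearMap.range ((star x : Bdd H) : H →ₗ[ℂ] H)
      ≤ K.map ((star x : Bdd H) : H →ₗ[ℂ] H) := by
    rintro _ ⟨h, rfl⟩
    refine ⟨K.starProjection h, Submodule.starProjection_apply_mem K h, ?_⟩
    have key : (star x : Bdd H) (h - K.starProjection h) = 0 := by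
      refine ext_inner_right ℂ fun v => ?_
      rw [ContinuousLinearMap.star_eq_adjoint, ContinuousLinearMap.adjoint_inner_left,
        inner_zero_left]
      exact (Submodule.mem_orthogonal' _ _).1
        (Submodule.sub_starProjection_mem_orthogonal h) _ ⟨v, rfl⟩
    rw [map_sub, sub_eq_zero] at key
    exact key.symm
  exact Submodule.finiteDimensional_of_le hle

/-- For a linear subspace `W` of a Hilbert space `H`: the *-algebra of the finite-rank
operators `x ∈ B(H)` such that the ranges of `x` and of `x*` are contained in `W`. -/
def finiteRankInto (W : Submodule ℂ H) : NonUnitalStarSubalgebra ℂ (Bdd H) where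
  carrier := {x | FiniteDimensional ℂ (LinearMap.range (x : H →ₗ[ℂ] H)) ∧
    (∀ h, x h ∈ W) ∧ ∀ h, (star x : Bdd H) h ∈ W}
  zero_mem' := by
    refine ⟨?_, fun h => by simp, fun h => by simp⟩
    refine Submodule.finiteDimensional_of_le (S₂ := ⊥) ?_
    rintro _ ⟨h, rfl⟩
    simp
  add_mem' := by
    rintro x y ⟨hx, hx1, hx2⟩ ⟨hy, hy1, hy2⟩
    refine ⟨?_, fun h => W.add_mem (hx1 h) (hy1 h), fun h => ?_⟩
    · refine Submodule.finiteDimensional_of_le (S₂ := LinearMap.range (x : H →ₗ[ℂ] H) ⊔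
        LinearMap.range (y : H →ₗ[ℂ] H)) ?_
      rintro _ ⟨h, rfl⟩
      exact Submodule.add_mem_sup ⟨h, rfl⟩ ⟨h, rfl⟩
    · rw [star_add]
      exact W.add_mem (hx2 h) (hy2 h)
  mul_mem' := by
    rintro x y ⟨hx, hx1, hx2⟩ ⟨hy, hy1, hy2⟩
    refine ⟨?_, fun h => hx1 (y h), fun h => ?_⟩
    · refine Submodule.finiteDimensional_of_le (S₂ := LinearMap.range (x : H →ₗ[ℂ] H)) ?_
      rintro _ ⟨h, rfl⟩
      exact ⟨y h, rfl⟩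
    · rw [star_mul]
      exact hy2 _
  smul_mem' := by
    rintro c x ⟨hx, hx1, hx2⟩
    refine ⟨?_, fun h => W.smul_mem c (hx1 h), fun h => ?_⟩
    · refine Submodule.finiteDimensional_of_le (S₂ := LinearMap.range (x : H →ₗ[ℂ] H)) ?_
      rintro _ ⟨h, rfl⟩
      exact ⟨c • h, by simp⟩
    · rw [star_smul]
      exact W.smul_mem _ (hx2 h)
  star_mem' := by
    rintro x ⟨hx, hx1, hx2⟩
    exact ⟨finiteDimensional_range_star hx, hx2, fun h => by rw [star_star]; exact hx1 h⟩

end Basic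

/-- The *-algebra `F(V)` of an inner product space `V`: the finite-rank bounded operators `x` on
the completion of `V` such that the ranges of `x` and of `x*` are contained in `V`. -/
noncomputable def finiteRankAlgebra (V : Type*) [NormedAddCommGroup V] [InnerProductSpace ℂ V] :
    NonUnitalStarSubalgebra ℂ (Bdd (UniformSpace.Completion V)) :=
  finiteRankInto (LinearMap.range
    (UniformSpace.Completion.toComplₗᵢ (𝕜 := ℂ) (E := V)).toLinearMap)

section DirectSum

variable {I : Type*} {H : I → Type*} [∀ i, NormedAddCommGroup (H i)]
  [∀ i, InnerProductSpace ℂ (H i)] [∀ i, CompleteSpace (H i)]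

open Classical in
/-- The isometric inclusion of `H i` into the Hilbert space direct sum of the `H i`. -/
noncomputable def summandInclusion (H : I → Type*) [∀ i, NormedAddCommGroup (H i)]
    [∀ i, InnerProductSpace ℂ (H i)] (i : I) : H i →L[ℂ] lp H 2 :=
  lp.singleContinuousLinearMap ℂ H 2 i

/-- The operator on the Hilbert space direct sum that acts as `x` on the summand `H i` and as `0`
on its orthogonal complement: coordinate projection onto `H i`, then `x`, then inclusion. -/
noncomputable def extendOperator (i : I) (x : Bdd (H i)) : Bdd (lp H 2) :=
  summandInclusion H i ∘L x ∘L lp.evalCLM ℂ H 2 i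

/-- The direct sum `⨁ A i`: the *-subalgebra of bounded operators on the Hilbert space direct sum
of the `H i` generated by the operators in the `A i`, each extended by `0`. -/
noncomputable def directSumAlgebra (A : ∀ i, NonUnitalStarSubalgebra ℂ (Bdd (H i))) :
    NonUnitalStarSubalgebra ℂ (Bdd (lp H 2)) :=
  NonUnitalStarAlgebra.adjoin ℂ {T | ∃ (i : I) (x : Bdd (H i)), x ∈ A i ∧ T = extendOperator i x}

/-- The algebra `⨁ F(V i)` of a family of complex inner product spaces `V i`, acting on the Hilbert
space direct sum of the completions of the `V i`. -/
noncomputable def directSumFiniteRank (V : I → Type*) [∀ i, NormedAddCommGroup (V i)]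
    [∀ i, InnerProductSpace ℂ (V i)] :
    NonUnitalStarSubalgebra ℂ (Bdd (lp (fun i => UniformSpace.Completion (V i)) 2)) :=
  directSumAlgebra fun i => finiteRankAlgebra (V i)

end DirectSum

/-!
The direct sum `⨁ F(V i)` consists of finite-rank operators, and every *-algebra of finite-rank
operators is a purely atomic R*-algebra. Regularity holds because `a = x* x` is algebraic: a
self-adjoint operator annihilated by a nonzero polynomial is annihilated by `t * p(t)` with
`p(0) ≠ 0`, so `x p(x* x) = 0`, which expresses `x` as `x y x` with `y` in the algebra
(`isRStarAlgebra_of_finiteRank`). Atomicity is induction on the rank: a nonzero projection of least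
rank below a given one is an atom (`isPurelyAtomic_of_finiteRank`).

Conversely, let `A` be a purely atomic R*-algebra. Every `x ∈ A` has a range projection in `A`
(`IsRStarAlgebra.exists_rangeProjection`). Hence all nonzero elements of the corner `p A p` at an
atom `p` are invertible in it, and comparing with a spectral value in `B(H)` gives `p A p = ℂ p`
(`IsAtomOf.exists_corner_eq_smul`). Therefore `p A q ≠ 0` is an equivalence relation on the atoms.
Choose an atom `p i` in each class, a unit vector `ξ i` in its range, and let `V i = A ξ i ⊆ H`, an
inner product space isometric to the left ideal `A p i`. The `V i` are mutually orthogonal and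
invariant under `A`. Cutting an element down by its left and right range projections, both finite
sums of atoms, shows that `A` is spanned by the products `a * star b` with `a, b ∈ A p i`
(`AtomSystem.mem_span`). On the closed span of the `V i` such a product acts as the rank-one operator
`|a ξ i⟩⟨b ξ i|` of the `i`-th summand (`AtomSystem.compress_mul_star`), and these operators span
`⨁ F(V i)`. So compression to the closed span of the `V i`, identified with the Hilbert space direct
sum of their completions, is a *-homomorphism of `A` onto `⨁ F(V i)`. It is injective because an
element that vanishes on every `V i` annihilates the spanning products.
-/

/-! ### *-algebras of finite-rank operators -/

section FiniteRank

/-- A finite-rank operator `a` is algebraic: the characteristic polynomial of its restriction to its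
range annihilates that range. -/
theorem exists_mul_aeval_eq_zero {H : Type*} [NormedAddCommGroup H]
    [InnerProductSpace ℂ H] {a : Bdd H}
    (ha : FiniteDimensional ℂ (LinearMap.range (a : H →ₗ[ℂ] H))) :
    ∃ p : Polynomial ℂ, p ≠ 0 ∧ a * Polynomial.aeval a p = 0 := by
  set R := LinearMap.range (a : H →ₗ[ℂ] H) with hR
  let f : R →ₗ[ℂ] R := (a : H →ₗ[ℂ] H).restrict fun x _ => ⟨x, rfl⟩
  have hpow : ∀ (n : ℕ) (r : R), (a ^ n) (r : H) = ((f ^ n) r : R) := by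
    intro n
    induction n with
    | zero => intro r; simp
    | succ n ih => intro r; rw [pow_succ, pow_succ]; exact ih (f r)
  have key : ∀ (p : Polynomial ℂ) (r : R),
      (Polynomial.aeval a p) (r : H) = ((Polynomial.aeval f p) r : R) := by
    intro p
    induction p using Polynomial.induction_on' with
    | add p q hp hq => intro r; simp [hp, hq]
    | monomial n c =>
      intro r
      simp only [Polynomial.aeval_monomial, ← Algebra.smul_def]
      simp [hpow]
  refine ⟨f.charpoly, f.charpoly_monic.ne_zero, ?_⟩
  have hcomm : a * Polynomial.aeval a f.charpoly = Polynomial.aeval a f.charpoly * a := by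
    simpa using ((Polynomial.commute_X f.charpoly).map (Polynomial.aeval a)).eq
  rw [hcomm]
  ext h
  have := key f.charpoly ⟨a h, h, rfl⟩
  rw [LinearMap.aeval_self_charpoly] at this
  simpa using this

variable {H : Type*} [NormedAddCommGroup H] [InnerProductSpace ℂ H] [CompleteSpace H]
  {A : NonUnitalStarSubalgebra ℂ (Bdd H)}

/-- A nonunital subalgebra absorbs products with polynomials in one of its elements, even if the
polynomial has a constant term. -/
theorem aeval_mul_mem {a z : Bdd H} (ha : a ∈ A) (hz : z ∈ A) (r : Polynomial ℂ) :
    Polynomial.aeval a r * z ∈ A := by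
  induction r using Polynomial.induction_on' with
  | add p q hp hq => rw [map_add, add_mul]; exact add_mem hp hq
  | monomial n c =>
    rw [Polynomial.aeval_monomial, mul_assoc, ← Algebra.smul_def]
    refine A.smul_mem' c ?_
    induction n with
    | zero => simpa using hz
    | succ n ih => rw [pow_succ', mul_assoc]; exact mul_mem ha ih

/-- A self-adjoint finite-rank operator is annihilated by `t * p(t)` for a polynomial `p` with
nonzero constant term, because `ker a ^ 2 = ker a`. -/
theorem IsSelfAdjoint.exists_mul_aeval_eq_zero {a : Bdd H} (hsa : IsSelfAdjoint a)
    (ha : FiniteDimensional ℂ (LinearMap.range (a : H →ₗ[ℂ] H))) :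
    ∃ p : Polynomial ℂ, p.coeff 0 ≠ 0 ∧ a * Polynomial.aeval a p = 0 := by
  have key : ∀ (n : ℕ) (p : Polynomial ℂ), p.natDegree = n → p ≠ 0 →
      a * Polynomial.aeval a p = 0 →
      ∃ p : Polynomial ℂ, p.coeff 0 ≠ 0 ∧ a * Polynomial.aeval a p = 0 := by
    intro n
    induction n using Nat.strong_induction_on with
    | _ n ih =>
      intro p hn hp h0
      by_cases hc : p.coeff 0 = 0
      · have hX : Polynomial.X * p.divX = p := by
          have := p.X_mul_divX_add
          rwa [hc, map_zero, add_zero] at this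
        have hd : p.divX ≠ 0 := by
          rintro h
          rw [h, mul_zero] at hX
          exact hp hX.symm
        have hdeg : p.divX.natDegree < n := by
          have h1 := Polynomial.natDegree_X_mul hd
          rw [hX] at h1
          omega
        refine ih _ hdeg p.divX rfl hd ?_
        have h1 : star a * (a * Polynomial.aeval a p.divX) = 0 := by
          rw [hsa.star_eq, ← h0]
          conv_rhs => rw [← hX, map_mul, Polynomial.aeval_X]
        have h2 : star (a * Polynomial.aeval a p.divX) * (a * Polynomial.aeval a p.divX) = 0 := by
          rw [star_mul, mul_assoc, h1, mul_zero]
        exact CStarRing.star_mul_self_eq_zero_iff _ |>.1 h2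
      · exact ⟨p, hc, h0⟩
  obtain ⟨p, hp, h0⟩ := _root_.exists_mul_aeval_eq_zero ha
  exact key _ p rfl hp h0

theorem isRStarAlgebra_of_finiteRank
    (hA : ∀ x ∈ A, FiniteDimensional ℂ (LinearMap.range (x : H →ₗ[ℂ] H))) : IsRStarAlgebra A := by
  intro x hx
  have ha : star x * x ∈ A := mul_mem (star_mem hx) hx
  set a := star x * x with hadef
  obtain ⟨p, hc, h0⟩ := (IsSelfAdjoint.star_mul_self x).exists_mul_aeval_eq_zero (hA _ ha)
  rw [← hadef] at h0
  have hz : x * Polynomial.aeval a p = 0 := by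
    refine CStarRing.star_mul_self_eq_zero_iff _ |>.1 ?_
    rw [star_mul, mul_assoc, ← mul_assoc (star x), ← hadef, h0, mul_zero]
  -- `x p(x*x) = 0` reads `x r(x*x) x* x = - p(0) x` with `p = r X + p(0)`
  have hexp : x * (Polynomial.aeval a p.divX * star x) * x = -(p.coeff 0 • x) := by
    have h1 := hz
    rw [← p.divX_mul_X_add, map_add, map_mul, Polynomial.aeval_X, Polynomial.aeval_C, mul_add,
      ← Algebra.commutes, ← Algebra.smul_def, hadef] at h1
    rw [eq_neg_iff_add_eq_zero, ← h1, hadef]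
    simp only [mul_assoc]
  refine ⟨(-(p.coeff 0)⁻¹) • (Polynomial.aeval a p.divX * star x),
    A.smul_mem' _ (aeval_mul_mem ha (star_mem hx) _), ?_⟩
  rw [mul_smul_comm, smul_mul_assoc, hexp, smul_neg, neg_smul, neg_neg, smul_smul,
    inv_mul_cancel₀ hc, one_smul]

end FiniteRank

section Projections

variable {H : Type*} [NormedAddCommGroup H] [InnerProductSpace ℂ H] [CompleteSpace H]
  {A : NonUnitalStarSubalgebra ℂ (Bdd H)}

theorem projLE_iff_mul_eq {p q : Bdd H} (hp : IsStarProjection p) : ProjLE q p ↔ p * q = q := by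
  constructor
  · intro h
    ext x
    obtain ⟨y, hy⟩ := h ⟨x, rfl⟩
    rw [mul_apply_eq_comp, ← hy, ← mul_apply_eq_comp,
      hp.isIdempotentElem.eq]
  · rintro h _ ⟨x, rfl⟩
    exact ⟨q x, by rw [← mul_apply_eq_comp, h]⟩

theorem mul_eq_of_mul_eq {p q : Bdd H} (hp : IsStarProjection p) (hq : IsStarProjection q)
    (h : p * q = q) : q * p = q := by
  have := congrArg star h
  rwa [star_mul, hp.isSelfAdjoint.star_eq, hq.isSelfAdjoint.star_eq] at this

theorem eq_of_projLE_of_projLE {p q : Bdd H} (hp : IsStarProjection p) (hq : IsStarProjection q)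
    (hpq : ProjLE p q) (hqp : ProjLE q p) : p = q := by
  rw [projLE_iff_mul_eq hq] at hpq
  rw [projLE_iff_mul_eq hp] at hqp
  rw [← mul_eq_of_mul_eq hq hp hpq, hqp]

theorem finrank_range_lt {p q : Bdd H} (hp : IsStarProjection p) (hq : IsStarProjection q)
    (hfin : FiniteDimensional ℂ (LinearMap.range (p : H →ₗ[ℂ] H))) (hle : ProjLE q p)
    (hne : q ≠ p) :
    Module.finrank ℂ (LinearMap.range (q : H →ₗ[ℂ] H)) <
      Module.finrank ℂ (LinearMap.range (p : H →ₗ[ℂ] H)) := by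
  have hle' : LinearMap.range (q : H →ₗ[ℂ] H) ≤ LinearMap.range (p : H →ₗ[ℂ] H) := by
    rintro x ⟨y, hy⟩
    exact hle ⟨y, hy⟩
  refine Submodule.finrank_lt_finrank_of_lt (lt_of_le_of_ne hle' fun h => hne ?_)
  refine eq_of_projLE_of_projLE hq hp hle ?_
  rintro x ⟨y, hy⟩
  have : x ∈ LinearMap.range (q : H →ₗ[ℂ] H) := h ▸ ⟨y, hy⟩
  exact this

/-- Below a nonzero finite-rank projection, a nonzero projection of least rank is an atom. -/
theorem exists_atom_projLE
    (hA : ∀ x ∈ A, FiniteDimensional ℂ (LinearMap.range (x : H →ₗ[ℂ] H))) {p : Bdd H}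
    (hp : p ∈ projections A) (h0 : p ≠ 0) : ∃ q, IsAtomOf A q ∧ ProjLE q p := by
  induction hn : Module.finrank ℂ (LinearMap.range (p : H →ₗ[ℂ] H))
    using Nat.strong_induction_on generalizing p with
  | _ n ih =>
    by_cases hat : ∀ q ∈ projections A \ {0}, ProjLE q p → q = p
    · exact ⟨p, ⟨⟨hp, h0⟩, hat⟩, fun _ h => h⟩
    · push Not at hat
      obtain ⟨q, ⟨hq, hq0⟩, hqp, hne⟩ := hat
      obtain ⟨r, hr, hrq⟩ := ih _ (hn ▸ finrank_range_lt hp.2 hq.2 (hA _ hp.1) hqp hne) hq hq0 rfl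
      exact ⟨r, hr, hrq.trans hqp⟩

theorem isPurelyAtomic_of_finiteRank
    (hA : ∀ x ∈ A, FiniteDimensional ℂ (LinearMap.range (x : H →ₗ[ℂ] H))) : IsPurelyAtomic A := by
  intro p hp
  induction hn : Module.finrank ℂ (LinearMap.range (p : H →ₗ[ℂ] H))
    using Nat.strong_induction_on generalizing p with
  | _ n ih =>
    by_cases h0 : p = 0
    · exact ⟨0, Fin.elim0, fun k => k.elim0, by simp [h0]⟩
    · obtain ⟨q, hq, hqp⟩ := exists_atom_projLE hA hp h0
      have hmul := (projLE_iff_mul_eq hp.2).1 hqp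
      have hsub : p - q ∈ projections A :=
        ⟨sub_mem hp.1 hq.1.1.1, hq.1.1.2.sub_of_mul_eq_right hp.2 hmul⟩
      have hle : ProjLE (p - q) p := by
        rw [projLE_iff_mul_eq hp.2, mul_sub, hmul, hp.2.isIdempotentElem.eq]
      have hne : p - q ≠ p := fun h => hq.1.2 (by simpa using h)
      obtain ⟨m, f, hf, hsum⟩ :=
        ih _ (hn ▸ finrank_range_lt hp.2 hsub.2 (hA _ hp.1) hle hne) (p - q) hsub rfl
      refine ⟨m + 1, Fin.cons q f, fun k => ?_, ?_⟩
      · refine Fin.cases ?_ (fun k => ?_) k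
        · exact hq
        · exact hf k
      · rw [Fin.sum_univ_succ]
        simp [← hsum]

end Projections

/-! ### Range projections and the corners at atoms -/

section Corners

variable {H : Type*} [NormedAddCommGroup H] [InnerProductSpace ℂ H] [CompleteSpace H]
  {A : NonUnitalStarSubalgebra ℂ (Bdd H)}

/-- Every element `x` of an R*-algebra has a range projection in the algebra. With `a = x * star x`
and `y` an inner inverse of `a ^ 2`, it is `a * y * a`. -/
theorem IsRStarAlgebra.exists_rangeProjection (hA : IsRStarAlgebra A) {x : Bdd H} (hx : x ∈ A) :
    ∃ e ∈ projections A, e * x = x ∧ ∃ w ∈ A, e = x * w := by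
  have ha : x * star x ∈ A := mul_mem hx (star_mem hx)
  have hsa : star (x * star x) = x * star x := (IsSelfAdjoint.mul_star_self x).star_eq
  set a := x * star x with hadef
  clear_value a
  obtain ⟨y, hy, hyy⟩ := hA (a * a) (mul_mem ha ha)
  have hcancel : ∀ z : Bdd H, a * (a * z) = 0 → a * z = 0 := by
    intro z hz
    refine CStarRing.star_mul_self_eq_zero_iff _ |>.1 ?_
    rw [star_mul, hsa, mul_assoc, hz, mul_zero]
  have key : ∀ y : Bdd H, a * a * y * (a * a) = a * a → a * y * a * a = a := by
    intro y hyy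
    have h := hcancel (y * a * a - 1) (by
      rw [← sub_eq_zero] at hyy
      rw [← hyy]; noncomm_ring)
    rw [← sub_eq_zero, ← h]; noncomm_ring
  have h1 : a * y * a * a = a := key y hyy
  have h2 : a * star y * a * a = a := by
    refine key _ ?_
    have := congrArg star hyy
    simpa only [star_mul, hsa, mul_assoc] using this
  have h4 : star (a * y * a) * (a * y * a) = a * y * a := by
    rw [star_mul (a * y) a, star_mul a y, hsa]
    calc a * (star y * a) * (a * y * a) = (a * star y * a * a) * (y * a) := by noncomm_ring
      _ = a * y * a := by rw [h2, mul_assoc]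
  have hself : star (a * y * a) = a * y * a := by
    have := congrArg star h4
    rw [star_mul, star_star, h4] at this
    exact this.symm
  refine ⟨a * y * a, ⟨mul_mem (mul_mem ha hy) ha, ?_, hself⟩, ?_, star x * (y * a),
    mul_mem (star_mem hx) (mul_mem hy ha), by simp only [hadef, mul_assoc]⟩
  · rwa [hself] at h4
  · have h5 : (a * y * a * x - x) * star (a * y * a * x - x) = 0 := by
      calc (a * y * a * x - x) * star (a * y * a * x - x)
          = (a * y * a * (x * star x) - x * star x) * star (a * y * a - 1) := by
            simp only [star_sub, star_mul, star_one]; noncomm_ring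
        _ = 0 := by rw [← hadef, h1, sub_self, zero_mul]
    exact sub_eq_zero.1 (CStarRing.mul_star_self_eq_zero_iff _ |>.1 h5)

theorem IsAtomOf.mem {p : Bdd H} (hp : IsAtomOf A p) : p ∈ A := hp.1.1.1

theorem IsAtomOf.mul_self {p : Bdd H} (hp : IsAtomOf A p) : p * p = p :=
  hp.1.1.2.isIdempotentElem.eq

theorem IsAtomOf.star_eq {p : Bdd H} (hp : IsAtomOf A p) : star p = p :=
  hp.1.1.2.isSelfAdjoint.star_eq

theorem IsAtomOf.ne_zero {p : Bdd H} (hp : IsAtomOf A p) : p ≠ 0 := hp.1.2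

/-- In the corner `p A p` at an atom, every nonzero element is right invertible. -/
theorem IsAtomOf.exists_mul_eq (hA : IsRStarAlgebra A) {p x : Bdd H} (hp : IsAtomOf A p)
    (hx : x ∈ A) (hpx : p * x = x) (h0 : x ≠ 0) : ∃ w ∈ A, x * w = p := by
  obtain ⟨e, he, hex, w, hw, hew⟩ := hA.exists_rangeProjection hx
  refine ⟨w, hw, ?_⟩
  rw [← hew]
  refine hp.2 e ⟨he, ?_⟩ ((projLE_iff_mul_eq hp.1.1.2).2 ?_)
  · rintro rfl
    exact h0 (by rw [← hex, zero_mul])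
  · rw [hew, ← mul_assoc, hpx]

/-- A self-adjoint element of the corner `p A p` at an atom is a multiple of `p`: if `c` is a nonzero
spectral value of `x` of absolute value `‖x‖`, then `x - c p` is not invertible in the corner, hence
vanishes. -/
theorem IsAtomOf.exists_smul_of_isSelfAdjoint (hA : IsRStarAlgebra A) {p x : Bdd H}
    (hp : IsAtomOf A p) (hx : x ∈ A) (hpx : p * x = x) (hsa : IsSelfAdjoint x) :
    ∃ c : ℂ, x = c • p := by
  by_cases h0 : x = 0
  · exact ⟨0, by simp [h0]⟩
  have : Nontrivial (Bdd H) := ⟨x, 0, h0⟩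
  obtain ⟨c, hc, hcn⟩ := spectrum.exists_nnnorm_eq_spectralRadius x
  rw [hsa.spectralRadius_eq_nnnorm] at hcn
  have hc0 : c ≠ 0 := by
    rintro rfl
    have : ‖x‖₊ = 0 := by simpa using hcn.symm
    exact h0 (nnnorm_eq_zero.1 this)
  refine ⟨c, ?_⟩
  by_contra hne
  have hxp : x * p = x := by
    have := congrArg star hpx
    rwa [star_mul, hp.star_eq, hsa.star_eq] at this
  -- both `x - c p` and its adjoint are right invertible in the corner
  have hmem : x - c • p ∈ A := sub_mem hx (A.smul_mem' c hp.mem)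
  obtain ⟨w, hw, hxw⟩ := hp.exists_mul_eq hA hmem
    (by rw [mul_sub, hpx, mul_smul_comm, hp.mul_self]) (sub_ne_zero.2 hne)
  obtain ⟨v, hv, hxv⟩ := hp.exists_mul_eq hA (star_mem hmem)
    (by rw [star_sub, star_smul, hsa.star_eq, hp.star_eq, mul_sub, hpx, mul_smul_comm, hp.mul_self])
    (star_ne_zero.2 (sub_ne_zero.2 hne))
  have hvx : star v * (x - c • p) = p := by
    have := congrArg star hxv
    rwa [star_mul, star_star, hp.star_eq] at this
  have hpy : p * (x - c • p) = x - c • p := by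
    rw [mul_sub, hpx, mul_smul_comm, hp.mul_self]
  have hyp : (x - c • p) * p = x - c • p := by
    rw [sub_mul, hxp, smul_mul_assoc, hp.mul_self]
  -- an inverse of `x - c` is the inverse in the corner minus `c⁻¹ (1 - p)`
  refine hc ?_
  have hfac : algebraMap ℂ (Bdd H) c - x = -((x - c • p) - c • (1 - p)) := by
    rw [Algebra.algebraMap_eq_smul_one, smul_sub]; abel
  rw [spectrum.mem_resolventSet_iff, hfac]
  refine IsUnit.neg ?_
  set y := x - c • p
  clear_value y
  have hr : (y - c • (1 - p)) * (p * w * p - c⁻¹ • (1 - p)) = 1 := by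
    have e1 : y * (p * w * p) = p := by
      rw [mul_assoc, ← mul_assoc, hyp, ← mul_assoc, hxw, hp.mul_self]
    have e2 : y * (1 - p) = 0 := by rw [mul_sub, mul_one, hyp, sub_self]
    have e3 : (1 - p) * (p * w * p) = 0 := by
      rw [mul_assoc, ← mul_assoc, sub_mul, one_mul, hp.mul_self, sub_self, zero_mul]
    have e4 : (1 - p) * (1 - p) = 1 - p := by
      rw [mul_sub, mul_one, sub_mul, one_mul, hp.mul_self, sub_self, sub_zero]
    rw [sub_mul, mul_sub, mul_sub, e1, mul_smul_comm, e2, smul_mul_assoc, e3, smul_mul_assoc,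
      mul_smul_comm, e4, smul_smul, mul_inv_cancel₀ hc0]
    simp
  have hl : (p * star v * p - c⁻¹ • (1 - p)) * (y - c • (1 - p)) = 1 := by
    have e1 : (p * star v * p) * y = p := by
      rw [mul_assoc, hpy, mul_assoc, hvx, hp.mul_self]
    have e2 : (1 - p) * y = 0 := by rw [sub_mul, one_mul, hpy, sub_self]
    have e3 : (p * star v * p) * (1 - p) = 0 := by
      rw [mul_assoc, mul_sub, mul_one, hp.mul_self, sub_self, mul_zero]
    have e4 : (1 - p) * (1 - p) = 1 - p := by
      rw [mul_sub, mul_one, sub_mul, one_mul, hp.mul_self, sub_self, sub_zero]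
    rw [sub_mul, mul_sub, mul_sub, e1, mul_smul_comm, e3, smul_mul_assoc, e2, smul_mul_assoc,
      mul_smul_comm, e4, smul_smul, inv_mul_cancel₀ hc0]
    simp
  exact isUnit_iff_exists.2 ⟨_, hr, left_inv_eq_right_inv hl hr ▸ hl⟩

/-- The corner `p A p` at an atom is `ℂ p`. -/
theorem IsAtomOf.exists_corner_eq_smul (hA : IsRStarAlgebra A) {p x : Bdd H} (hp : IsAtomOf A p)
    (hx : x ∈ A) : ∃ c : ℂ, p * x * p = c • p := by
  have hy : p * x * p ∈ A := mul_mem (mul_mem hp.mem hx) hp.mem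
  have hpy : p * (p * x * p) = p * x * p := by rw [← mul_assoc, ← mul_assoc, hp.mul_self]
  have hpy' : p * star (p * x * p) = star (p * x * p) := by
    rw [star_mul, hp.star_eq, ← mul_assoc, hp.mul_self]
  set y := p * x * p
  obtain ⟨c, hc⟩ := hp.exists_smul_of_isSelfAdjoint hA (x := y + star y)
    (add_mem hy (star_mem hy)) (by rw [mul_add, hpy, hpy']) (IsSelfAdjoint.add_star_self y)
  obtain ⟨d, hd⟩ := hp.exists_smul_of_isSelfAdjoint hA (x := Complex.I • (y - star y))
    (A.smul_mem' _ (sub_mem hy (star_mem hy)))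
    (by rw [mul_smul_comm, mul_sub, hpy, hpy'])
    (by rw [IsSelfAdjoint, star_smul, star_sub, star_star]; simp [smul_sub, neg_add_eq_sub])
  refine ⟨(c - Complex.I * d) / 2, ?_⟩
  have h2 : (2 : ℂ) • y = (y + star y) - Complex.I • (Complex.I • (y - star y)) := by
    rw [smul_smul, Complex.I_mul_I, two_smul, neg_one_smul]; abel
  rw [hc, hd, smul_smul, ← sub_smul] at h2
  rw [div_eq_inv_mul, mul_smul, ← h2, smul_smul]
  norm_num

/-- An intertwiner `v` starting at an atom `p` satisfies `star v * v ∈ ℂ p`, with a nonzero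
coefficient unless `v = 0`. -/
theorem IsAtomOf.exists_star_mul_self (hA : IsRStarAlgebra A) {p v : Bdd H} (hp : IsAtomOf A p)
    (hv : v ∈ A) (hvp : v * p = v) (h0 : v ≠ 0) : ∃ c : ℂ, c ≠ 0 ∧ star v * v = c • p := by
  obtain ⟨c, hc⟩ := hp.exists_corner_eq_smul hA (mul_mem (star_mem hv) hv)
  have hpv : p * star v = star v := by
    have := congrArg star hvp
    rwa [star_mul, hp.star_eq] at this
  rw [← mul_assoc, hpv, mul_assoc, hvp] at hc
  refine ⟨c, ?_, hc⟩
  rintro rfl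
  rw [zero_smul] at hc
  exact h0 (CStarRing.star_mul_self_eq_zero_iff _ |>.1 hc)

/-- Two projections are linked if the algebra contains a nonzero operator from one to the other. On
atoms this is Murray–von Neumann equivalence. -/
def IsLinked (A : NonUnitalStarSubalgebra ℂ (Bdd H)) (p q : Bdd H) : Prop :=
  ∃ x ∈ A, p * x * q ≠ 0

theorem IsAtomOf.isLinked_self {p : Bdd H} (hp : IsAtomOf A p) : IsLinked A p p :=
  ⟨p, hp.mem, by rw [hp.mul_self, hp.mul_self]; exact hp.ne_zero⟩

theorem IsLinked.symm {p q : Bdd H} (hp : IsAtomOf A p) (hq : IsAtomOf A q)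
    (h : IsLinked A p q) : IsLinked A q p := by
  obtain ⟨x, hx, h0⟩ := h
  refine ⟨star x, star_mem hx, fun h => h0 ?_⟩
  have := congrArg star h
  simpa [star_mul, hp.star_eq, hq.star_eq, mul_assoc] using this

theorem IsLinked.trans (hA : IsRStarAlgebra A) {p q r : Bdd H} (hp : IsAtomOf A p)
    (hq : IsAtomOf A q) (hpq : IsLinked A p q) (hqr : IsLinked A q r) : IsLinked A p r := by
  obtain ⟨x, hx, hx0⟩ := hpq
  obtain ⟨y, hy, hy0⟩ := hqr
  obtain ⟨c, hc0, hc⟩ := hq.exists_star_mul_self hA (mul_mem (mul_mem hp.mem hx) hq.mem)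
    (by rw [mul_assoc, hq.mul_self]) hx0
  refine ⟨x * q * y, mul_mem (mul_mem hx hq.mem) hy, fun h => hy0 ?_⟩
  have h1 : star (p * x * q) * (p * x * q) * (y * r) = 0 := by
    rw [mul_assoc, show p * x * q * (y * r) = p * (x * q * y) * r by simp only [mul_assoc], h,
      mul_zero]
  rw [hc, smul_mul_assoc, ← mul_assoc] at h1
  exact (smul_eq_zero.1 h1).resolve_left hc0

/-- Linkedness as an equivalence relation on the atoms of an R*-algebra. -/
def linkedSetoid (hA : IsRStarAlgebra A) : Setoid {p : Bdd H // IsAtomOf A p} where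
  r p q := IsLinked A p.1 q.1
  iseqv := ⟨fun p => p.2.isLinked_self, fun {p q} h => h.symm p.2 q.2,
    fun {p q _} h h' => h.trans hA p.2 q.2 h'⟩

end Corners

/-! ### Finite-rank operators and the Hilbert space direct sum -/

section Ambient

variable {H : Type*} [NormedAddCommGroup H] [InnerProductSpace ℂ H]

/-- A finite-rank operator is the sum of the rank-one operators `|e k⟩⟨x* e k|`, where `e` is an
orthonormal basis of its range. -/
theorem exists_eq_sum_rankOne [CompleteSpace H] {W : Submodule ℂ H} {x : Bdd H}
    (hx : x ∈ finiteRankInto W) : ∃ (n : ℕ) (a b : Fin n → W),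
      x = ∑ k, InnerProductSpace.rankOne ℂ (a k : H) (b k : H) := by
  obtain ⟨hfin, hW, hW'⟩ := hx
  set R := LinearMap.range (x : H →ₗ[ℂ] H) with hR
  have hRW : ∀ r : R, (r : H) ∈ W := by
    rintro ⟨_, h, rfl⟩
    exact hW h
  let e := stdOrthonormalBasis ℂ R
  refine ⟨_, fun k => ⟨e k, hRW _⟩, fun k => ⟨star x (e k : H), hW' _⟩, ?_⟩
  ext h
  have h1 := e.sum_repr' (⟨x h, h, rfl⟩ : R)
  have h2 := congrArg (Subtype.val : R → H) h1
  refine h2.symm.trans ?_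
  simp [ContinuousLinearMap.star_eq_adjoint, ContinuousLinearMap.adjoint_inner_left]

theorem rankOne_mem_finiteRankInto [CompleteSpace H] {W : Submodule ℂ H} {a b : H} (ha : a ∈ W)
    (hb : b ∈ W) : InnerProductSpace.rankOne ℂ a b ∈ finiteRankInto W := by
  refine ⟨Submodule.finiteDimensional_of_le (S₂ := Submodule.span ℂ {a}) ?_, fun h => ?_,
    fun h => ?_⟩
  · rintro _ ⟨h, rfl⟩
    exact Submodule.smul_mem _ _ (Submodule.mem_span_singleton_self a)
  · exact W.smul_mem _ ha
  · rw [ContinuousLinearMap.star_eq_adjoint, InnerProductSpace.adjoint_rankOne]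
    exact W.smul_mem _ hb

/-- The isometric identification of the completion of a subspace of a Hilbert space with the closure
of that subspace, as an embedding into the Hilbert space. -/
noncomputable def completionEmbedding [CompleteSpace H] (V : Submodule ℂ H) :
    UniformSpace.Completion V →ₗᵢ[ℂ] H where
  toLinearMap := (V.subtypeL.extend (UniformSpace.Completion.toComplL (𝕜 := ℂ) (E := V))).toLinearMap
  norm_map' v := by
    have hcoe : ∀ v : V, V.subtypeL.extend (UniformSpace.Completion.toComplL (𝕜 := ℂ) (E := V))
        (v : UniformSpace.Completion V) = v := fun v =>
      ContinuousLinearMap.extend_eq _ UniformSpace.Completion.denseRange_coe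
        (UniformSpace.Completion.isUniformInducing_coe V) v
    induction v using UniformSpace.Completion.induction_on with
    | hp => exact isClosed_eq (ContinuousLinearMap.continuous _).norm continuous_norm
    | ih v =>
      rw [UniformSpace.Completion.norm_coe]
      exact congrArg norm (hcoe v)

@[simp]
theorem completionEmbedding_coe [CompleteSpace H] (V : Submodule ℂ H) (v : V) :
    completionEmbedding V (v : UniformSpace.Completion V) = v :=
  ContinuousLinearMap.extend_eq _ UniformSpace.Completion.denseRange_coe
    (UniformSpace.Completion.isUniformInducing_coe V) v

end Ambient

section DirectSum

variable {I : Type*} {G : I → Type*} [∀ i, NormedAddCommGroup (G i)]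
  [∀ i, InnerProductSpace ℂ (G i)]

@[simp]
theorem summandInclusion_apply_self (i : I) (x : G i) : summandInclusion G i x i = x := by
  simp [summandInclusion]

theorem summandInclusion_apply_of_ne {i j : I} (h : i ≠ j) (x : G j) :
    summandInclusion G j x i = 0 := by
  simp [summandInclusion, h]

theorem OrthogonalFamily.linearIsometry_summandInclusion {E : Type*} [NormedAddCommGroup E]
    [InnerProductSpace ℂ E] [CompleteSpace E] {V : ∀ i, G i →ₗᵢ[ℂ] E}
    (hV : OrthogonalFamily ℂ G V) (i : I) (x : G i) :
    hV.linearIsometry (summandInclusion G i x) = V i x := by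
  classical
  rw [← hV.linearIsometry_apply_single]
  congr!

theorem extendOperator_apply (i : I) (x : Bdd (G i)) (k : lp G 2) :
    extendOperator i x k = summandInclusion G i (x (k i)) := rfl

theorem extendOperator_sum (i : I) {n : ℕ} (f : Fin n → Bdd (G i)) :
    extendOperator i (∑ k, f k) = ∑ k, extendOperator i (f k) := by
  ext1 k
  simp [extendOperator_apply]

theorem finiteDimensional_range_extendOperator (i : I) {x : Bdd (G i)}
    (hx : FiniteDimensional ℂ (LinearMap.range (x : G i →ₗ[ℂ] G i))) :
    FiniteDimensional ℂ (LinearMap.range (extendOperator i x : lp G 2 →ₗ[ℂ] lp G 2)) := by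
  refine Submodule.finiteDimensional_of_le
    (S₂ := (LinearMap.range (x : G i →ₗ[ℂ] G i)).map (summandInclusion G i).toLinearMap) ?_
  rintro _ ⟨k, rfl⟩
  exact ⟨x (k i), ⟨k i, rfl⟩, rfl⟩

end DirectSum

theorem finiteDimensional_range_of_mem_directSumFiniteRank {I : Type*} {V : I → Type*}
    [∀ i, NormedAddCommGroup (V i)] [∀ i, InnerProductSpace ℂ (V i)]
    {x : Bdd (lp (fun i => UniformSpace.Completion (V i)) 2)} (hx : x ∈ directSumFiniteRank V) :
    FiniteDimensional ℂ (LinearMap.range (x : lp (fun i => UniformSpace.Completion (V i)) 2 →ₗ[ℂ]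
      lp (fun i => UniformSpace.Completion (V i)) 2)) := by
  have hle : directSumFiniteRank V ≤ finiteRankInto ⊤ := by
    refine NonUnitalStarAlgebra.adjoin_le ?_
    rintro _ ⟨i, y, hy, rfl⟩
    exact ⟨finiteDimensional_range_extendOperator i hy.1, fun _ => trivial, fun _ => trivial⟩
  exact (hle hx).1

/-- Continuous linear maps on a Hilbert space direct sum of completions are determined by their
values on the vectors of the uncompleted summands. -/
theorem directSum_hom_ext {I : Type*} {V : I → Type*} [∀ i, NormedAddCommGroup (V i)]
    [∀ i, InnerProductSpace ℂ (V i)] {E : Type*} [NormedAddCommGroup E] [InnerProductSpace ℂ E]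
    {f g : lp (fun i => UniformSpace.Completion (V i)) 2 →L[ℂ] E}
    (h : ∀ i (v : V i), f (summandInclusion (fun i => UniformSpace.Completion (V i)) i v) =
      g (summandInclusion (fun i => UniformSpace.Completion (V i)) i v)) : f = g := by
  classical
  refine lp.ext_continuousLinearMap (𝕜 := ℂ) (by simp) fun i => ?_
  ext x
  have hfg : f ∘L summandInclusion (fun i => UniformSpace.Completion (V i)) i =
      g ∘L summandInclusion (fun i => UniformSpace.Completion (V i)) i := by
    ext x
    induction x using UniformSpace.Completion.induction_on with
    | hp => exact isClosed_eq (ContinuousLinearMap.continuous _) (ContinuousLinearMap.continuous _)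
    | ih v => exact h i v
  have := congrArg (fun T => T x) hfg
  simp only [summandInclusion, ContinuousLinearMap.comp_apply] at this ⊢
  convert this

/-! ### Orbits of atoms -/

section AtomSystem

variable {H : Type*} [NormedAddCommGroup H] [InnerProductSpace ℂ H] [CompleteSpace H]

/-- One atom `proj i` in each class of linked atoms, together with a unit vector `vec i` in its
range. -/
structure AtomSystem (A : NonUnitalStarSubalgebra ℂ (Bdd H)) (I : Type*) where
  /-- The representing atoms. -/
  proj : I → Bdd H
  /-- The chosen unit vectors. -/
  vec : I → H
  isAtomOf_proj : ∀ i, IsAtomOf A (proj i)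
  norm_vec : ∀ i, ‖vec i‖ = 1
  proj_vec : ∀ i, proj i (vec i) = vec i
  proj_mul_mul_proj : ∀ i j, i ≠ j → ∀ x ∈ A, proj i * x * proj j = 0
  exists_isLinked : ∀ q, IsAtomOf A q → ∃ i, IsLinked A q (proj i)

variable {A : NonUnitalStarSubalgebra ℂ (Bdd H)}

theorem IsAtomOf.exists_unit_vector {p : Bdd H} (hp : IsAtomOf A p) :
    ∃ ξ : H, ‖ξ‖ = 1 ∧ p ξ = ξ := by
  obtain ⟨h, hh⟩ : ∃ h, p h ≠ 0 := by
    by_contra! hall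
    exact hp.ne_zero (ContinuousLinearMap.ext hall)
  refine ⟨((‖p h‖⁻¹ : ℝ) : ℂ) • p h, ?_, ?_⟩
  · rw [norm_smul]
    simp [hh]
  · rw [map_smul, ← mul_apply_eq_comp, hp.mul_self]

theorem IsRStarAlgebra.nonempty_atomSystem (hA : IsRStarAlgebra A) :
    Nonempty (AtomSystem A (Quotient (linkedSetoid hA))) := by
  choose ξ hξ hξ' using fun i : Quotient (linkedSetoid hA) => i.out.2.exists_unit_vector
  refine ⟨⟨fun i => i.out.1, ξ, fun i => i.out.2, hξ, hξ', fun i j hij x hx => ?_,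
    fun q hq => ⟨Quotient.mk _ ⟨q, hq⟩, ?_⟩⟩⟩
  · by_contra h0
    refine hij ?_
    rw [← Quotient.out_eq i, ← Quotient.out_eq j]
    exact Quotient.sound ⟨x, hx, h0⟩
  · exact (linkedSetoid hA).symm' (Quotient.mk_out (s := linkedSetoid hA) ⟨q, hq⟩)

variable {I : Type*} (S : AtomSystem A I)

/-- An operator from one atom to another factors through one of the representing atoms. -/
theorem AtomSystem.exists_eq_mul_star (hA : IsRStarAlgebra A) {p q x : Bdd H} (hp : IsAtomOf A p)
    (hq : IsAtomOf A q) (hx : x ∈ A) :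
    ∃ i, ∃ a ∈ A, ∃ b ∈ A, a * S.proj i = a ∧ b * S.proj i = b ∧ p * x * q = a * star b := by
  obtain ⟨i, hqi⟩ := S.exists_isLinked q hq
  have hi := S.isAtomOf_proj i
  obtain ⟨v, hv, hv0⟩ := hqi
  obtain ⟨c, hc0, hc⟩ := hq.exists_star_mul_self hA
    (v := star (q * v * S.proj i)) (star_mem (mul_mem (mul_mem hq.mem hv) hi.mem))
    (by rw [star_mul, star_mul, hq.star_eq, mul_assoc, mul_assoc, hq.mul_self])
    (star_ne_zero.2 hv0)
  rw [star_star] at hc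
  have hvi : q * v * S.proj i * S.proj i = q * v * S.proj i := by rw [mul_assoc, hi.mul_self]
  have hvm : q * v * S.proj i ∈ A := mul_mem (mul_mem hq.mem hv) hi.mem
  generalize q * v * S.proj i = b at hvi hc hvm
  -- `q = c⁻¹ b b*`, so `p x q = (c⁻¹ p x b) b*`
  refine ⟨i, c⁻¹ • (p * x * b), A.smul_mem' _ (mul_mem (mul_mem hp.mem hx) hvm), b, hvm, ?_, hvi, ?_⟩
  · rw [smul_mul_assoc, mul_assoc, hvi]
  · rw [smul_mul_assoc, mul_assoc (p * x), hc, mul_smul_comm, smul_smul, inv_mul_cancel₀ hc0,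
      one_smul]

/-- A purely atomic R*-algebra is spanned by the operators `a * star b`, where `a` and `b` start at
the same representing atom: cut down an element by its left and right range projections and
decompose these into atoms. -/
theorem AtomSystem.mem_span (hA : IsRStarAlgebra A) (hat : IsPurelyAtomic A) {x : Bdd H}
    (hx : x ∈ A) : x ∈ Submodule.span ℂ {T | ∃ i, ∃ a ∈ A, ∃ b ∈ A,
      a * S.proj i = a ∧ b * S.proj i = b ∧ T = a * star b} := by
  obtain ⟨e, he, hex, -⟩ := hA.exists_rangeProjection hx
  obtain ⟨f, hf, hfx, -⟩ := hA.exists_rangeProjection (star_mem hx)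
  have hxf : x * f = x := by
    have := congrArg star hfx
    rwa [star_mul, star_star, hf.2.isSelfAdjoint.star_eq] at this
  obtain ⟨m, p, hp, hpe⟩ := hat e he
  obtain ⟨n, q, hq, hqf⟩ := hat f hf
  have hsum : x = ∑ k, ∑ l, p k * x * q l := by
    conv_lhs => rw [← hxf, ← hex, hpe, hqf, Finset.sum_mul, Finset.sum_mul]
    simp_rw [Finset.mul_sum]
  rw [hsum]
  refine Submodule.sum_mem _ fun k _ => Submodule.sum_mem _ fun l _ => ?_
  obtain ⟨i, a, ha, b, hb, h⟩ := S.exists_eq_mul_star hA (hp k) (hq l) hx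
  exact Submodule.subset_span ⟨i, a, ha, b, hb, h⟩

/-- The inner product space attached to the atom `proj i`: the orbit of the vector `vec i` under the
algebra. It is isometric to the left ideal `A * proj i`. -/
def AtomSystem.orbit (i : I) : Submodule ℂ H where
  carrier := {h | ∃ x ∈ A, x (S.vec i) = h}
  zero_mem' := ⟨0, zero_mem A, rfl⟩
  add_mem' := by
    rintro _ _ ⟨x, hx, rfl⟩ ⟨y, hy, rfl⟩
    exact ⟨x + y, add_mem hx hy, rfl⟩
  smul_mem' := by
    rintro c _ ⟨x, hx, rfl⟩
    exact ⟨c • x, A.smul_mem' c hx, rfl⟩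

theorem AtomSystem.apply_mem_orbit {i : I} {x : Bdd H} (hx : x ∈ A) {h : H} (hh : h ∈ S.orbit i) :
    x h ∈ S.orbit i := by
  obtain ⟨y, hy, rfl⟩ := hh
  exact ⟨x * y, mul_mem hx hy, rfl⟩

theorem AtomSystem.mul_apply_vec (i : I) (x : Bdd H) :
    (x * S.proj i) (S.vec i) = x (S.vec i) := by
  rw [mul_apply_eq_comp, S.proj_vec]

/-- The atom `proj i` annihilates the orbits of the other atoms. -/
theorem AtomSystem.proj_apply_of_mem_orbit_of_ne {i j : I} (hij : i ≠ j) {h : H}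
    (hh : h ∈ S.orbit j) : S.proj i h = 0 := by
  obtain ⟨y, hy, rfl⟩ := hh
  have := congrArg (fun T : Bdd H => T (S.vec j)) (S.proj_mul_mul_proj i j hij y hy)
  rwa [S.mul_apply_vec] at this

/-- The atom `proj i` acts on the orbit of `vec i` as the projection onto the line of `vec i`. -/
theorem AtomSystem.proj_apply_of_mem_orbit (hA : IsRStarAlgebra A) {i : I} {h : H}
    (hh : h ∈ S.orbit i) : S.proj i h = inner ℂ (S.vec i) h • S.vec i := by
  obtain ⟨y, hy, rfl⟩ := hh
  have hi := S.isAtomOf_proj i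
  obtain ⟨c, hc⟩ := hi.exists_corner_eq_smul hA hy
  have h1 : S.proj i (y (S.vec i)) = c • S.vec i := by
    have := congrArg (fun T : Bdd H => T (S.vec i)) hc
    rw [S.mul_apply_vec] at this
    rw [← mul_apply_eq_comp, this]
    change c • S.proj i (S.vec i) = _
    rw [S.proj_vec]
  have h2 : inner ℂ (S.vec i) (y (S.vec i)) = c := by
    conv_lhs => rw [← S.proj_vec i, ← hi.star_eq]
    rw [ContinuousLinearMap.star_eq_adjoint, ContinuousLinearMap.adjoint_inner_left,
      ← ContinuousLinearMap.star_eq_adjoint, hi.star_eq, S.proj_vec, h1, inner_smul_right,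
      inner_self_eq_norm_sq_to_K, S.norm_vec]
    simp
  rw [h1, h2]

theorem AtomSystem.inner_eq_zero {i j : I} (hij : i ≠ j) {h k : H} (hh : h ∈ S.orbit i)
    (hk : k ∈ S.orbit j) : inner ℂ h k = 0 := by
  obtain ⟨x, hx, rfl⟩ := hh
  have hi := S.isAtomOf_proj i
  have h0 := S.proj_apply_of_mem_orbit_of_ne hij (S.apply_mem_orbit (star_mem hx) hk)
  rw [← S.mul_apply_vec, ← ContinuousLinearMap.adjoint_inner_right,
    ← ContinuousLinearMap.star_eq_adjoint, star_mul, hi.star_eq, mul_apply_eq_comp, h0,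
    inner_zero_right]

/-- The elements `a * star b` of the algebra act on the orbits as rank-one operators. -/
theorem AtomSystem.mul_star_apply (hA : IsRStarAlgebra A) {i : I} {a b : Bdd H} (hb : b ∈ A)
    (hbi : b * S.proj i = b) {j : I} {h : H} (hh : h ∈ S.orbit j) :
    (a * star b) h = inner ℂ (b (S.vec i)) h • a (S.vec i) := by
  have hi := S.isAtomOf_proj i
  have hib : star b = S.proj i * star b := by
    have := congrArg star hbi
    rw [star_mul, hi.star_eq] at this
    exact this.symm
  have hbh := S.apply_mem_orbit (star_mem hb) hh
  by_cases hij : i = j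
  · subst hij
    rw [hib, mul_apply_eq_comp, mul_apply_eq_comp, S.proj_apply_of_mem_orbit hA hbh, map_smul,
      ContinuousLinearMap.star_eq_adjoint, ContinuousLinearMap.adjoint_inner_right]
  · rw [S.inner_eq_zero hij ⟨b, hb, rfl⟩ hh, hib, mul_apply_eq_comp, mul_apply_eq_comp,
      S.proj_apply_of_mem_orbit_of_ne hij hbh, map_zero, zero_smul]

/-! ### The representation on the direct sum of the orbits -/

theorem AtomSystem.orthogonalFamily : OrthogonalFamily ℂ
    (fun i => UniformSpace.Completion (S.orbit i)) fun i => completionEmbedding (S.orbit i) := by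
  intro i j hij v w
  induction v, w using UniformSpace.Completion.induction_on₂ with
  | hp =>
    exact isClosed_eq (((completionEmbedding _).continuous.comp continuous_fst).inner
      ((completionEmbedding _).continuous.comp continuous_snd)) continuous_const
  | ih v w =>
    rw [completionEmbedding_coe, completionEmbedding_coe]
    exact S.inner_eq_zero hij v.2 w.2

/-- The Hilbert space direct sum of the completed orbits. -/
abbrev AtomSystem.Sum : Type _ := lp (fun i => UniformSpace.Completion (S.orbit i)) 2

/-- The isometry from the direct sum of the completed orbits into `H`. -/
noncomputable def AtomSystem.isometry : S.Sum →L[ℂ] H :=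
  S.orthogonalFamily.linearIsometry.toContinuousLinearMap

/-- The inclusion of an orbit into the direct sum. -/
noncomputable def AtomSystem.incl (i : I) (v : S.orbit i) : S.Sum :=
  summandInclusion (fun i => UniformSpace.Completion (S.orbit i)) i v

theorem AtomSystem.isometry_incl (i : I) (v : S.orbit i) : S.isometry (S.incl i v) = v := by
  have := S.orthogonalFamily.linearIsometry_summandInclusion i
    (v : UniformSpace.Completion (S.orbit i))
  rw [completionEmbedding_coe] at this
  exact this

theorem AtomSystem.adjoint_isometry_apply (k : S.Sum) :
    ContinuousLinearMap.adjoint S.isometry (S.isometry k) = k := by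
  refine ext_inner_left ℂ fun l => ?_
  rw [ContinuousLinearMap.adjoint_inner_right]
  exact S.orthogonalFamily.linearIsometry.inner_map_map l k

theorem AtomSystem.adjoint_isometry_coe {i : I} (v : S.orbit i) :
    ContinuousLinearMap.adjoint S.isometry (v : H) = S.incl i v := by
  rw [← S.isometry_incl, S.adjoint_isometry_apply]

/-- The compression of an operator on `H` to the direct sum of the completed orbits. -/
noncomputable def AtomSystem.compress (x : Bdd H) : Bdd S.Sum :=
  ContinuousLinearMap.adjoint S.isometry ∘L x ∘L S.isometry

theorem AtomSystem.compress_apply (x : Bdd H) (k : S.Sum) :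
    S.compress x k = ContinuousLinearMap.adjoint S.isometry (x (S.isometry k)) := rfl

theorem AtomSystem.compress_incl {x : Bdd H} (hx : x ∈ A) {i : I} (v : S.orbit i) :
    S.compress x (S.incl i v) = S.incl i ⟨x v, S.apply_mem_orbit hx v.2⟩ := by
  rw [S.compress_apply, S.isometry_incl, ← S.adjoint_isometry_coe]

/-- The compression is multiplicative on the algebra, because the orbits are invariant. -/
theorem AtomSystem.compress_mul (x : Bdd H) {y : Bdd H} (hy : y ∈ A) :
    S.compress (x * y) = S.compress x * S.compress y := by
  refine directSum_hom_ext fun i v => ?_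
  change S.compress (x * y) (S.incl i v) = S.compress x (S.compress y (S.incl i v))
  rw [S.compress_incl hy, S.compress_apply, S.compress_apply, S.isometry_incl, S.isometry_incl]
  rfl

theorem AtomSystem.compress_star (x : Bdd H) : S.compress (star x) = star (S.compress x) := by
  simp only [ContinuousLinearMap.star_eq_adjoint, AtomSystem.compress,
    ContinuousLinearMap.adjoint_comp, ContinuousLinearMap.adjoint_adjoint,
    ContinuousLinearMap.comp_assoc]

/-- The compression as a *-homomorphism on the algebra. -/
noncomputable def AtomSystem.rep : A →⋆ₙₐ[ℂ] Bdd S.Sum where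
  toFun x := S.compress x
  map_smul' c x := by ext1 k; simp [S.compress_apply]
  map_zero' := by ext1 k; simp [S.compress_apply]
  map_add' x y := by ext1 k; simp [S.compress_apply]
  map_mul' x y := S.compress_mul x y.2
  map_star' x := S.compress_star x

/-- The compression is injective on the algebra: an element that vanishes on all orbits annihilates
every `a * star b`, hence the whole algebra. -/
theorem AtomSystem.rep_injective (hA : IsRStarAlgebra A) (hat : IsPurelyAtomic A) :
    Function.Injective S.rep := by
  rw [injective_iff_map_eq_zero]
  rintro ⟨x, hx⟩ h0
  have hvec : ∀ i, ∀ h ∈ S.orbit i, x h = 0 := by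
    intro i h hh
    have h1 := S.compress_incl hx ⟨h, hh⟩
    rw [show S.compress x = 0 from h0] at h1
    have h2 := congrArg S.isometry h1
    rw [S.isometry_incl] at h2
    simpa using h2.symm
  have hzero : ∀ i, ∀ a ∈ A, a * S.proj i = a → x * a = 0 := by
    intro i a ha hai
    -- `star (x a) (x a) = c proj i`, and evaluation at `vec i` gives `c = 0`
    by_contra hne
    obtain ⟨c, hc0, hc⟩ := (S.isAtomOf_proj i).exists_star_mul_self hA (mul_mem hx ha)
      (by rw [mul_assoc, hai]) hne
    have h1 := congrArg (fun T : Bdd H => T (S.vec i)) hc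
    have h2 : (x * a) (S.vec i) = 0 := hvec i _ ⟨a, ha, rfl⟩
    have h3 : c • S.vec i = 0 := by
      have h4 : (c • S.proj i) (S.vec i) = 0 := by
        rw [← hc, mul_apply_eq_comp, h2, map_zero]
      rwa [_root_.smul_apply, S.proj_vec] at h4
    have h5 := S.norm_vec i
    rw [(smul_eq_zero.1 h3).resolve_left hc0, norm_zero] at h5
    exact zero_ne_one h5
  have hann : ∀ y ∈ Submodule.span ℂ {T | ∃ i, ∃ a ∈ A, ∃ b ∈ A,
      a * S.proj i = a ∧ b * S.proj i = b ∧ T = a * star b}, x * y = 0 := by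
    intro y hy
    induction hy using Submodule.span_induction with
    | mem y hy =>
      obtain ⟨i, a, ha, b, -, hai, -, rfl⟩ := hy
      rw [← mul_assoc, hzero i a ha hai, zero_mul]
    | zero => rw [mul_zero]
    | add y z _ _ hy hz => rw [mul_add, hy, hz, add_zero]
    | smul c y _ hy => rw [mul_smul_comm, hy, smul_zero]
  have hxx := hann (star x) (S.mem_span hA hat (star_mem hx))
  exact Subtype.ext (CStarRing.mul_star_self_eq_zero_iff _ |>.1 hxx)

/-- The element `a * star b` is compressed to the rank-one operator `|a ξ⟩⟨b ξ|` on the `i`-th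
summand, where `ξ = vec i`. -/
theorem AtomSystem.compress_mul_star (hA : IsRStarAlgebra A) {i : I} {a b : Bdd H} (ha : a ∈ A)
    (hb : b ∈ A) (hbi : b * S.proj i = b) :
    S.compress (a * star b) =
      extendOperator (H := fun i => UniformSpace.Completion (S.orbit i)) i
      (InnerProductSpace.rankOne ℂ
      ((⟨a (S.vec i), a, ha, rfl⟩ : S.orbit i) : UniformSpace.Completion (S.orbit i))
      ((⟨b (S.vec i), b, hb, rfl⟩ : S.orbit i) : UniformSpace.Completion (S.orbit i))) := by
  refine directSum_hom_ext fun j w => ?_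
  change S.compress (a * star b) (S.incl j w) = _
  rw [S.compress_apply, S.isometry_incl, S.mul_star_apply hA hb hbi w.2, map_smul,
    S.adjoint_isometry_coe (⟨a (S.vec i), a, ha, rfl⟩ : S.orbit i), extendOperator_apply,
    InnerProductSpace.rankOne_apply, map_smul]
  refine congrArg₂ _ ?_ rfl
  by_cases hij : i = j
  · subst hij
    rw [summandInclusion_apply_self, UniformSpace.Completion.inner_coe]
    rfl
  · rw [summandInclusion_apply_of_ne hij, inner_zero_right]
    exact S.inner_eq_zero hij ⟨b, hb, rfl⟩ w.2

/-- The compression maps the algebra into `⨁ F(orbit i)`. -/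
theorem AtomSystem.rep_mem (hA : IsRStarAlgebra A) (hat : IsPurelyAtomic A) (x : A) :
    S.rep x ∈ directSumFiniteRank fun i => S.orbit i := by
  have key : ∀ y ∈ Submodule.span ℂ {T | ∃ i, ∃ a ∈ A, ∃ b ∈ A,
      a * S.proj i = a ∧ b * S.proj i = b ∧ T = a * star b},
      S.compress y ∈ directSumFiniteRank fun i => S.orbit i := by
    intro y hy
    induction hy using Submodule.span_induction with
    | mem y hy =>
      obtain ⟨i, a, ha, b, hb, -, hbi, rfl⟩ := hy
      rw [S.compress_mul_star hA ha hb hbi]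
      refine NonUnitalStarAlgebra.subset_adjoin ℂ _ ⟨i, _, ?_, rfl⟩
      exact rankOne_mem_finiteRankInto ⟨_, rfl⟩ ⟨_, rfl⟩
    | zero =>
      rw [show S.compress (0 : Bdd H) = 0 by ext1 k; simp [S.compress_apply]]
      exact zero_mem _
    | add y z _ _ hy hz =>
      rw [show S.compress (y + z) = S.compress y + S.compress z by
        ext1 k; simp [S.compress_apply]]
      exact add_mem hy hz
    | smul c y _ hy =>
      rw [show S.compress (c • y) = c • S.compress y by ext1 k; simp [S.compress_apply]]
      exact (directSumFiniteRank fun i => S.orbit i).smul_mem' c hy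
  exact key x (S.mem_span hA hat x.2)

/-- The compression maps the algebra onto `⨁ F(orbit i)`. -/
theorem AtomSystem.directSumFiniteRank_le_range (hA : IsRStarAlgebra A) :
    directSumFiniteRank (fun i => S.orbit i) ≤ NonUnitalStarAlgHom.range S.rep := by
  refine NonUnitalStarAlgebra.adjoin_le ?_
  rintro _ ⟨i, T, hT, rfl⟩
  obtain ⟨n, a, b, rfl⟩ := exists_eq_sum_rankOne hT
  rw [extendOperator_sum]
  refine sum_mem fun k _ => ?_
  obtain ⟨⟨_, ⟨⟨_, x, hx, rfl⟩, rfl⟩⟩, hak⟩ : ∃ z, z = a k := ⟨_, rfl⟩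
  obtain ⟨⟨_, ⟨⟨_, y, hy, rfl⟩, rfl⟩⟩, hbk⟩ : ∃ z, z = b k := ⟨_, rfl⟩
  have hi := S.isAtomOf_proj i
  have hxi : x * S.proj i ∈ A := mul_mem hx hi.mem
  have hyi : y * S.proj i ∈ A := mul_mem hy hi.mem
  refine ⟨⟨x * S.proj i * star (y * S.proj i), mul_mem hxi (star_mem hyi)⟩, ?_⟩
  refine (S.compress_mul_star hA hxi hyi (by rw [mul_assoc, hi.mul_self])).trans ?_
  rw [← hak, ← hbk]
  simp only [S.mul_apply_vec]
  rfl

end AtomSystem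

theorem nonempty_starAlgEquiv_of_injective {B C : Type*} [NonUnitalRing B] [StarRing B]
    [Module ℂ B] [NonUnitalRing C] [StarRing C] [Module ℂ C] {f : B →⋆ₙₐ[ℂ] C}
    (hf : Function.Injective f) {D : NonUnitalStarSubalgebra ℂ C} (hmem : ∀ x, f x ∈ D)
    (hle : D ≤ NonUnitalStarAlgHom.range f) : Nonempty (B ≃⋆ₐ[ℂ] D) := by
  refine ⟨StarAlgEquiv.ofBijective (NonUnitalStarAlgHom.codRestrict f D hmem)
    ⟨(NonUnitalStarAlgHom.injective_codRestrict _ _ _).2 hf, ?_⟩⟩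
  rintro ⟨T, hT⟩
  obtain ⟨x, hx⟩ := hle hT
  exact ⟨x, Subtype.ext hx⟩

theorem mainTheorem4 :
    (∀ (I : Type u) (V : I → Type v) [∀ i, NormedAddCommGroup (V i)]
        [∀ i, InnerProductSpace ℂ (V i)],
      IsRStarAlgebra (directSumFiniteRank V) ∧ IsPurelyAtomic (directSumFiniteRank V)) ∧
    (∀ (H : Type w) [NormedAddCommGroup H] [InnerProductSpace ℂ H] [CompleteSpace H]
        (A : NonUnitalStarSubalgebra ℂ (Bdd H)), IsRStarAlgebra A → IsPurelyAtomic A →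
      ∃ (I : Type w) (V : I → Type w) (_ : ∀ i, NormedAddCommGroup (V i))
        (_ : ∀ i, InnerProductSpace ℂ (V i)),
        Nonempty (A ≃⋆ₐ[ℂ] directSumFiniteRank V)) := by
  refine ⟨fun I V _ _ => ?_, fun H _ _ _ A hA hat => ?_⟩
  · have hfin := fun x (hx : x ∈ directSumFiniteRank V) =>
      finiteDimensional_range_of_mem_directSumFiniteRank hx
    exact ⟨isRStarAlgebra_of_finiteRank hfin, isPurelyAtomic_of_finiteRank hfin⟩
  · obtain ⟨S⟩ := hA.nonempty_atomSystem
    exact ⟨_, fun i => S.orbit i, fun i => Submodule.normedAddCommGroup _,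
      fun i => Submodule.innerProductSpace _, nonempty_starAlgEquiv_of_injective
        (S.rep_injective hA hat) (S.rep_mem hA hat) (S.directSumFiniteRank_le_range hA)⟩
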